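/- Let $G$ be a virtually abelian group (that is, $G$ has an abelian subgroup of finite index) and let $S\subseteq G$ be a finite set that generates $G$ as a monoid. Let $\omega\colon S\to\{1,2,3,\dots\}$ be any function, and for $g\in G$ put $$\omega(g)=\min\Bigl\{\sum_{i=1}^k\omega(s_i)\;\Bigm|\;k\ge 0,\ s_1,\dots,s_k\in S,\ s_1s_2\cdots s_k=g\Bigr\}.$$ Let $H$ be any subgroup of $G$ and, for $n\ge 0$, let $\sigma(n)=\#\{h\in H\mid \omega(h)=n\}$, which is finite. Then the formal power series $\sum_{n\ge 0}\sigma(n)z^n$ (the weighted growth series of $H$ relative to $G$) is a rational function: there are polynomials $p,q\in\mathbb{Z}[z]$ with $q\neq 0$ such that $$\sum_{n\ge 0}\sigma(n)z^n=\frac{p(z)}{q(z)}.$$ -/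

import Mathlib

namespace RelGrowth

/-- A group is virtually abelian if it has an abelian subgroup of finite index. -/
def IsVirtuallyAbelian (G : Type*) [Group G] : Prop :=
  ∃ A : Subgroup G, IsMulCommutative A ∧ A.FiniteIndex

/-- The element of `G` represented by a word over `S`. -/
def wordEval {G : Type*} [Group G] {S : Finset G} (w : List S) : G :=
  (w.map (fun s : S => (s : G))).prod

/-- The weight of a word: the sum of the weights of its letters. -/
def wordWeight {G : Type*} {S : Finset G} (ω : S → ℕ+) (w : List S) : ℕ :=
  (w.map (fun s : S => (ω s : ℕ))).sum

/-- The weight of an element: the minimal weight of a word representing it. If `S` generates `G`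
as a monoid, the infimum is attained, see `exists_word_weight`. -/
noncomputable def weight {G : Type*} [Group G] {S : Finset G} (ω : S → ℕ+) (g : G) : ℕ :=
  sInf {m : ℕ | ∃ w : List S, wordEval w = g ∧ wordWeight ω w = m}

/-- The weighted growth function of `H` relative to `G`: the number of elements of `H` of
weight `n` in `G`. The set counted is finite, see `finite_sphere`. -/
noncomputable def relGrowth {G : Type*} [Group G] {S : Finset G} (ω : S → ℕ+) (H : Subgroup G)
    (n : ℕ) : ℕ :=
  {g : G | g ∈ H ∧ weight ω g = n}.ncard

/-- The weighted growth series of `H` relative to `G`. -/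
noncomputable def relGrowthSeries {G : Type*} [Group G] {S : Finset G} (ω : S → ℕ+)
    (H : Subgroup G) : PowerSeries ℤ :=
  PowerSeries.mk fun n => (relGrowth ω H n : ℤ)

/-- A power series is a rational function if it equals `p / q` for integer polynomials `p`, `q`
with `q ≠ 0`. -/
def IsRationalSeries (F : PowerSeries ℤ) : Prop :=
  ∃ p q : Polynomial ℤ, q ≠ 0 ∧ (q : PowerSeries ℤ) * F = (p : PowerSeries ℤ)

theorem exists_word_weight {G : Type*} [Group G] {S : Finset G}
    (hS : Submonoid.closure (S : Set G) = ⊤) (ω : S → ℕ+) (g : G) :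
    ∃ w : List S, wordEval w = g ∧ wordWeight ω w = weight ω g := by
  have hne : {m : ℕ | ∃ w : List S, wordEval w = g ∧ wordWeight ω w = m}.Nonempty := by
    have hg : g ∈ Submonoid.closure (S : Set G) := hS ▸ Submonoid.mem_top g
    obtain ⟨l, hl, rfl⟩ := Submonoid.exists_list_of_mem_closure hg
    refine ⟨_, l.attach.map (fun x => ⟨x.1, Finset.mem_coe.1 (hl x.1 x.2)⟩), ?_, rfl⟩
    simp only [wordEval, List.map_map, Function.comp_def]
    exact congrArg List.prod (List.attach_map_subtype_val l)
  exact Nat.sInf_mem hne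

theorem length_le_wordWeight {G : Type*} {S : Finset G} (ω : S → ℕ+) (w : List S) :
    w.length ≤ wordWeight ω w := by
  induction w with
  | nil => simp
  | cons s w ih =>
    have := (ω s).pos
    simp only [wordWeight, List.map_cons, List.sum_cons, List.length_cons] at ih ⊢
    omega

theorem finite_sphere {G : Type*} [Group G] {S : Finset G}
    (hS : Submonoid.closure (S : Set G) = ⊤) (ω : S → ℕ+) (H : Subgroup G) (n : ℕ) :
    {g : G | g ∈ H ∧ weight ω g = n}.Finite := by
  refine ((List.finite_length_le S n).image wordEval).subset ?_
  rintro g ⟨-, hg⟩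
  obtain ⟨w, hw, hw'⟩ := exists_word_weight hS ω g
  exact ⟨w, by have := length_le_wordWeight ω w; simp only [Set.mem_ofPred_eq]; omega, hw⟩

end RelGrowth

/-! Replace spheres by the pairs `(h, n)` with `h ∈ H` of weight at most `n`: multiplying their
series by `1 - z` recovers the growth series, and "weight at most `n`" only asks for some word, so
no minimum has to be described. Let `A` be abelian of finite index. Each letter moves a coset in the
finite set `G ⧸ A` to another one, contributing an element of `A` and a weight. Words thus give path
labels in `A × ℕ` of a finite graph, which are semilinear by Kleene's algorithm
(`isSemilinearSet_isPathLabel`). Closing upwards in `ℕ` and imposing membership in `H`, a coset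
condition on `A`, preserves this (`isSemilinearSet_cosetBall`).

In a cancellative commutative monoid, a semilinear set with finitely many elements per degree has
rational series (`isRationalSeries_of_isSemilinearSet`): inclusion–exclusion reduces to finitely
many cosets of one finitely generated submonoid, and lexicographically least representatives turn
these into lower sets of `ℕ ^ m`. -/

open Set

namespace RelGrowth

/-! ### Closure properties of rational series -/

namespace IsRationalSeries

variable {F F' : PowerSeries ℤ}

theorem zero : IsRationalSeries 0 := ⟨0, 1, one_ne_zero, by simp⟩

theorem add (hF : IsRationalSeries F) (hF' : IsRationalSeries F') :
    IsRationalSeries (F + F') := by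
  obtain ⟨p, q, hq, h⟩ := hF
  obtain ⟨p', q', hq', h'⟩ := hF'
  refine ⟨q' * p + q * p', q * q', mul_ne_zero hq hq', ?_⟩
  push_cast
  rw [← h, ← h']
  ring

theorem polynomial_mul (r : Polynomial ℤ) (hF : IsRationalSeries F) :
    IsRationalSeries (r * F) := by
  obtain ⟨p, q, hq, h⟩ := hF
  refine ⟨r * p, q, hq, ?_⟩
  push_cast
  rw [← h]
  ring

theorem of_polynomial_mul {r : Polynomial ℤ} (hr : r ≠ 0) (h : IsRationalSeries (r * F)) :
    IsRationalSeries F := by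
  obtain ⟨p, q, hq, h⟩ := h
  refine ⟨p, q * r, mul_ne_zero hq hr, ?_⟩
  push_cast
  rw [← h]
  ring

theorem sub (hF : IsRationalSeries F) (hF' : IsRationalSeries F') :
    IsRationalSeries (F - F') := by
  simpa [sub_eq_add_neg] using hF.add (hF'.polynomial_mul (-1))

theorem X_pow_mul (c : ℕ) (hF : IsRationalSeries F) :
    IsRationalSeries (PowerSeries.X ^ c * F) := by
  simpa using hF.polynomial_mul (Polynomial.X ^ c)

end IsRationalSeries

/-! ### Counting series of graded sets -/

variable {α β : Type*}

/-- The series counting the elements of a set by their degree. -/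
noncomputable def degSeries (deg : α → ℕ) (s : Set α) : PowerSeries ℤ :=
  PowerSeries.mk fun n => (({x ∈ s | deg x = n} : Set α).ncard : ℤ)

/-- A set is graded-finite if it has finitely many elements of each degree. -/
def GradedFinite (deg : α → ℕ) (s : Set α) : Prop :=
  ∀ n, ({x ∈ s | deg x = n} : Set α).Finite

theorem GradedFinite.mono {deg : α → ℕ} {s t : Set α} (ht : GradedFinite deg t) (h : s ⊆ t) :
    GradedFinite deg s :=
  fun n => (ht n).subset fun _ hx => ⟨h hx.1, hx.2⟩

theorem degSeries_empty (deg : α → ℕ) : degSeries deg ∅ = 0 := by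
  ext n
  simp [degSeries]

theorem degSeries_union_add_inter {deg : α → ℕ} {s t : Set α} (hs : GradedFinite deg s)
    (ht : GradedFinite deg t) :
    degSeries deg (s ∪ t) + degSeries deg (s ∩ t) = degSeries deg s + degSeries deg t := by
  ext n
  simp only [degSeries, map_add, PowerSeries.coeff_mk]
  have := Set.ncard_union_add_ncard_inter _ _ (hs n) (ht n)
  have h₁ : {x | x ∈ s ∪ t ∧ deg x = n} = {x ∈ s | deg x = n} ∪ {x ∈ t | deg x = n} := by
    ext; simp only [mem_union, mem_ofPred_eq]; tauto
  have h₂ : {x | x ∈ s ∩ t ∧ deg x = n} = {x ∈ s | deg x = n} ∩ {x ∈ t | deg x = n} := by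
    ext; simp only [mem_inter_iff, mem_ofPred_eq]; tauto
  rw [h₁, h₂]
  exact_mod_cast this

theorem degSeries_union {deg : α → ℕ} {s t : Set α} (hs : GradedFinite deg s)
    (ht : GradedFinite deg t) (hst : Disjoint s t) :
    degSeries deg (s ∪ t) = degSeries deg s + degSeries deg t := by
  rw [← degSeries_union_add_inter hs ht, hst.inter_eq, degSeries_empty, add_zero]

theorem degSeries_image {deg : α → ℕ} {deg' : β → ℕ} {s : Set α} {f : α → β} (c : ℕ)
    (hf : InjOn f s) (hdeg : ∀ x ∈ s, deg' (f x) = c + deg x) :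
    degSeries deg' (f '' s) = PowerSeries.X ^ c * degSeries deg s := by
  ext n
  rw [PowerSeries.coeff_X_pow_mul']
  simp only [degSeries, PowerSeries.coeff_mk]
  split_ifs with h
  · have : {y | y ∈ f '' s ∧ deg' y = n} = f '' {x ∈ s | deg x = n - c} := by
      ext y
      constructor
      · rintro ⟨⟨x, hx, rfl⟩, h'⟩
        exact ⟨x, ⟨hx, by have := hdeg x hx; omega⟩, rfl⟩
      · rintro ⟨x, ⟨hx, hx'⟩, rfl⟩
        exact ⟨⟨x, hx, rfl⟩, by have := hdeg x hx; omega⟩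
    rw [this, InjOn.ncard_image (hf.mono fun x hx => hx.1)]
  · have : {y | y ∈ f '' s ∧ deg' y = n} = ∅ := by
      ext y
      simp only [mem_ofPred_eq, mem_empty_iff_false, iff_false]
      rintro ⟨⟨x, hx, rfl⟩, h'⟩
      have := hdeg x hx
      omega
    rw [this]
    simp

theorem GradedFinite.of_image {deg : α → ℕ} {deg' : β → ℕ} {s : Set α} {f : α → β} (c : ℕ)
    (hf : InjOn f s) (hdeg : ∀ x ∈ s, deg' (f x) = c + deg x) (h : GradedFinite deg' (f '' s)) :
    GradedFinite deg s := by
  intro n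
  refine Set.Finite.of_finite_image ((h (c + n)).subset ?_) (hf.mono fun x hx => hx.1)
  rintro _ ⟨x, ⟨hx, hx'⟩, rfl⟩
  exact ⟨⟨x, hx, rfl⟩, by rw [hdeg x hx, hx']⟩

/-! ### Lower sets in `ℕ ^ m` -/

/-- A decreasing sequence of lower sets in a well-quasi-order is eventually constant. -/
theorem exists_forall_subset_of_antitone [PartialOrder α] [WellQuasiOrderedLE α] {D : ℕ → Set α}
    (hD : Antitone D) (hD' : ∀ j, IsLowerSet (D j)) : ∃ J, ∀ j, D J ⊆ D j := by
  -- `U` has finitely many minimal elements; `J` is a stage by which all of them have left the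
  -- sequence.
  let U : Set α := ⋃ j, (D j)ᶜ
  have hfin : {x | Minimal (· ∈ U) x}.Finite :=
    (setOfPred_minimal_antichain _).finite_of_partiallyWellOrderedOn
      (Set.isPWO_of_wellQuasiOrderedLE _)
  have hmem : ∀ x ∈ U, ∃ j, x ∉ D j := by simp [U]
  choose! k hk using hmem
  obtain ⟨J, hJ⟩ := (hfin.image k).bddAbove
  refine ⟨J, fun j y hy => ?_⟩
  by_contra hyj
  have hyU : y ∈ U := mem_iUnion.2 ⟨j, hyj⟩
  obtain ⟨x, hxy, hx⟩ := exists_minimal_le_of_wellFoundedLT (· ∈ U) y hyU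
  exact hk x hx.1 (hD (hJ ⟨x, hx, rfl⟩) (hD' J hxy hy))

/-- The degree on `ℕ ^ m` given by weights of the coordinates. -/
def vecDeg {m : ℕ} (w x : Fin m → ℕ) : ℕ := ∑ i, w i * x i

theorem vecDeg_cons {m : ℕ} (w : Fin (m + 1) → ℕ) (j : ℕ) (x : Fin m → ℕ) :
    vecDeg w (Fin.cons j x) = w 0 * j + vecDeg (Fin.tail w) x := by
  simp [vecDeg, Fin.sum_univ_succ, Fin.tail]

/-- The slices `x 0 = j` are decreasing lower sets, hence constant from some `J` on. The part above
`J` is then a slice times a ray, giving a geometric series; finitely many slices remain. -/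
theorem isRationalSeries_of_isLowerSet {m : ℕ} (w : Fin m → ℕ) {D : Set (Fin m → ℕ)}
    (hD : IsLowerSet D) (hfin : GradedFinite (vecDeg w) D) :
    IsRationalSeries (degSeries (vecDeg w) D) := by
  induction m with
  | zero =>
    obtain rfl | ⟨x, hx⟩ := D.eq_empty_or_nonempty
    · rw [degSeries_empty]
      exact .zero
    · refine ⟨1, 1, one_ne_zero, ?_⟩
      ext n
      have hD : D = univ := by ext y; simpa [Subsingleton.elim y x] using hx
      subst hD
      rcases eq_or_ne n 0 with rfl | hn
      · simp [degSeries, vecDeg]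
      · simp [degSeries, vecDeg, hn, hn.symm, PowerSeries.coeff_one]
  | succ m ih =>
    let S : ℕ → Set (Fin m → ℕ) := fun j => {x | (Fin.cons j x : Fin (m + 1) → ℕ) ∈ D}
    let R : ℕ → Set (Fin (m + 1) → ℕ) := fun j => {x ∈ D | j ≤ x 0}
    have hSanti : Antitone S := fun i j hij x hx =>
      hD (Fin.cons_le_cons.2 ⟨hij, le_rfl⟩) hx
    have hSlow : ∀ j, IsLowerSet (S j) := fun j x y hyx hx =>
      hD (Fin.cons_le_cons.2 ⟨le_rfl, hyx⟩) hx
    have hinj : ∀ j, Function.Injective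
        (fun x : Fin m → ℕ => (Fin.cons j x : Fin (m + 1) → ℕ)) :=
      fun j x y hxy => (Fin.cons_injective2 hxy).2
    have hSim : ∀ j, (fun x : Fin m → ℕ => (Fin.cons j x : Fin (m + 1) → ℕ)) '' S j ⊆ D := by
      rintro j _ ⟨x, hx, rfl⟩
      exact hx
    have hSfin : ∀ j, GradedFinite (vecDeg (Fin.tail w)) (S j) := fun j =>
      (hfin.mono (hSim j)).of_image (w 0 * j) (hinj j).injOn fun x _ => vecDeg_cons w j x
    have hRfin : ∀ j, GradedFinite (vecDeg w) (R j) := fun j => hfin.mono fun x hx => hx.1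
    have hSrat := fun j => ih (Fin.tail w) (hSlow j) (hSfin j)
    have hRS : ∀ j, degSeries (vecDeg w) (R j) = PowerSeries.X ^ (w 0 * j) *
        degSeries (vecDeg (Fin.tail w)) (S j) + degSeries (vecDeg w) (R (j + 1)) := by
      intro j
      rw [← degSeries_image (deg' := vecDeg w) _ (hinj j).injOn fun x _ => vecDeg_cons w j x,
        ← degSeries_union (hfin.mono (hSim j)) (hRfin _)]
      · congr 1
        ext x
        constructor
        · rintro ⟨hx, hj⟩
          rcases hj.eq_or_lt with h | h
          · refine Or.inl ⟨Fin.tail x, ?_, ?_⟩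
            · simpa only [S, mem_ofPred_eq, h, Fin.cons_self_tail] using hx
            · simp only [h, Fin.cons_self_tail]
          · exact Or.inr ⟨hx, h⟩
        · rintro (⟨y, hy, rfl⟩ | ⟨hx, hj⟩)
          · exact ⟨hy, by simp⟩
          · exact ⟨hx, by omega⟩
      · rw [Set.disjoint_left]
        rintro _ ⟨y, hy, rfl⟩ ⟨-, h⟩
        simp at h
    obtain ⟨J, hJ⟩ := exists_forall_subset_of_antitone hSanti hSlow
    have hRJ : IsRationalSeries (degSeries (vecDeg w) (R J)) := by
      have hcons : ∀ x : Fin (m + 1) → ℕ, x ∈ R J → ∀ j, Fin.cons j (Fin.tail x) ∈ D := by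
        intro x hx j
        refine hJ j (hSanti hx.2 ?_)
        simpa only [S, mem_ofPred_eq, Fin.cons_self_tail] using hx.1
      -- If `w 0 = 0`, a point of `R J` would give infinitely many points of one degree.
      rcases Nat.eq_zero_or_pos (w 0) with hw | hw
      · have : R J = ∅ := by
          by_contra hne
          obtain ⟨x, hx⟩ := nonempty_iff_ne_empty.2 hne
          have hinj' : Function.Injective
              (fun j : ℕ => (Fin.cons j (Fin.tail x) : Fin (m + 1) → ℕ)) :=
            fun i j hij => (Fin.cons_injective2 hij).1
          refine Set.infinite_range_of_injective hinj'
            ((hfin (vecDeg (Fin.tail w) (Fin.tail x))).subset ?_)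
          rintro _ ⟨j, rfl⟩
          exact ⟨hcons x hx j, by simp [vecDeg_cons, hw]⟩
        rw [this, degSeries_empty]
        exact .zero
      · have hshift : R (J + 1) = (fun x => x + Pi.single 0 1) '' R J := by
          ext x
          constructor
          · rintro ⟨hx, hj⟩
            have hle : Pi.single 0 1 ≤ x := by
              intro i
              rcases eq_or_ne i 0 with rfl | hi
              · simp; omega
              · simp [hi]
            refine ⟨x - Pi.single 0 1, ⟨hD tsub_le_self hx, ?_⟩, tsub_add_cancel_of_le hle⟩
            simp
            omega
          · rintro ⟨y, hy, rfl⟩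
            refine ⟨?_, by simpa using hy.2⟩
            convert hcons y hy (y 0 + 1) using 1
            ext i
            refine Fin.cases ?_ (fun i => ?_) i <;> simp [Fin.tail]
        have heq := hRS J
        rw [hshift, degSeries_image (w 0) (add_left_injective _).injOn (deg := vecDeg w)] at heq
        · have hq : (1 - Polynomial.X ^ (w 0) : Polynomial ℤ) ≠ 0 := by
            intro h
            have := congrArg (Polynomial.eval 0) h
            simp [hw.ne'] at this
          refine IsRationalSeries.of_polynomial_mul hq ?_
          have : ((1 - Polynomial.X ^ (w 0) : Polynomial ℤ) : PowerSeries ℤ) *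
              degSeries (vecDeg w) (R J) = PowerSeries.X ^ (w 0 * J) *
              degSeries (vecDeg (Fin.tail w)) (S J) := by
            push_cast
            linear_combination heq
          rw [this]
          exact (hSrat J).X_pow_mul _
        · intro x _
          simp [vecDeg, mul_add, Finset.sum_add_distrib, Pi.single_apply, add_comm]
    have hall : ∀ i, i ≤ J → IsRationalSeries (degSeries (vecDeg w) (R (J - i))) := by
      intro i
      induction i with
      | zero => simpa using hRJ
      | succ i ih' =>
        intro hi
        rw [hRS, show J - (i + 1) + 1 = J - i by omega]
        exact ((hSrat _).X_pow_mul _).add (ih' (by omega))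
    have h0 := hall J le_rfl
    have : R (J - J) = D := by ext x; simp [R]
    rwa [this] at h0

/-! ### Rational series of semilinear sets -/

open scoped Pointwise

variable {M : Type*} [AddCommMonoid M]

theorem exists_addMonoidHom_of_fg {Q : AddSubmonoid M} (hQ : Q.FG) :
    ∃ (m : ℕ) (φ : (Fin m → ℕ) →+ M), AddMonoidHom.mrange φ = Q :=
  AddSubmonoid.fg_iff_exists_fin_addMonoidHom.1 hQ

theorem map_eq_vecDeg {m : ℕ} (ψ : (Fin m → ℕ) →+ ℕ) (x : Fin m → ℕ) :
    ψ x = vecDeg (fun i => ψ (Pi.single i 1)) x := by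
  have hx : x = ∑ i, x i • Pi.single i 1 := by
    ext j
    simp [Finset.sum_apply, Pi.single_apply]
  conv_lhs => rw [hx]
  simp only [vecDeg, map_sum, map_nsmul, smul_eq_mul, mul_comm]

/-- Lexicographically least representatives identify the part of a coset of a finitely generated
submonoid outside an absorbing set with a lower set in `ℕ ^ m`. -/
theorem isRationalSeries_coset_sdiff [IsCancelAdd M] (deg : M →+ ℕ) {m : ℕ}
    (φ : (Fin m → ℕ) →+ M) (b : M) {T : Set M} (hT : ∀ x ∈ T, ∀ k, x + φ k ∈ T)
    (hfin : GradedFinite deg (range (fun x => b + φ x) \ T)) :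
    IsRationalSeries (degSeries deg (range (fun x => b + φ x) \ T)) := by
  let D : Set (Fin m → ℕ) :=
    {x | b + φ x ∉ T ∧ ∀ y, φ y = φ x → toLex x ≤ toLex y}
  have hD : IsLowerSet D := by
    rintro x y hyx ⟨hx, hmin⟩
    obtain ⟨k, rfl⟩ := exists_add_of_le hyx
    refine ⟨fun h => hx ?_, fun z hz => ?_⟩
    · rw [map_add, ← add_assoc]
      exact hT _ h k
    -- The lexicographic order is translation invariant, so a smaller representative of `φ y` would
    -- yield one of `φ (y + k)`.
    · have := hmin (z + k) (by rw [map_add, map_add, hz])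
      rw [toLex_add, toLex_add] at this
      exact le_of_add_le_add_right this
  have himage : (fun x => b + φ x) '' D = range (fun x => b + φ x) \ T := by
    ext z
    constructor
    · rintro ⟨x, hx, rfl⟩
      exact ⟨⟨x, rfl⟩, hx.1⟩
    · rintro ⟨⟨x, rfl⟩, hx⟩
      obtain ⟨y, hy, hmin⟩ := WellFounded.has_min
        (wellFounded_lt (α := Lex (Fin m → ℕ))) {y | φ (ofLex y) = φ x} ⟨toLex x, rfl⟩
      refine ⟨ofLex y, ⟨?_, fun z hz => ?_⟩, ?_⟩
      · rwa [hy]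
      · exact not_lt.1 (hmin (toLex z) (hz.trans hy))
      · simp only [mem_ofPred_eq] at hy
        simp only [hy]
  have hinj : InjOn (fun x => b + φ x) D := by
    intro x hx y hy hxy
    have h : φ x = φ y := add_left_cancel hxy
    exact toLex_inj.1 (le_antisymm (hx.2 y h.symm) (hy.2 x h))
  have hdeg : ∀ x ∈ D, deg (b + φ x) =
      deg b + vecDeg (fun i => (deg.comp φ) (Pi.single i 1)) x := by
    intro x _
    rw [map_add, ← map_eq_vecDeg]
    rfl
  rw [← himage] at hfin ⊢
  rw [degSeries_image _ hinj hdeg]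
  exact (isRationalSeries_of_isLowerSet _ hD (hfin.of_image _ hinj hdeg)).X_pow_mul _

/-- A finite union of cosets of one finitely generated submonoid. -/
def IsFGSet (s : Set M) : Prop :=
  ∃ (B : Set M) (Q : AddSubmonoid M), B.Finite ∧ Q.FG ∧ s = B + (Q : Set M)

/-- Add cosets one at a time, counting only what is new; the union already counted absorbs `Q`. -/
theorem IsFGSet.isRationalSeries [IsCancelAdd M] (deg : M →+ ℕ) {s : Set M} (hs : IsFGSet s)
    (hfin : GradedFinite deg s) : IsRationalSeries (degSeries deg s) := by
  obtain ⟨B, Q, hB, hQ, rfl⟩ := hs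
  obtain ⟨m, φ, rfl⟩ := exists_addMonoidHom_of_fg hQ
  induction B, hB using Set.Finite.induction_on with
  | empty =>
    rw [empty_add, degSeries_empty]
    exact .zero
  | @insert b B _ _ ih =>
    have hb : {b} + (AddMonoidHom.mrange φ : Set M) = range (fun x => b + φ x) := by
      rw [singleton_add, AddMonoidHom.coe_mrange, ← range_comp]
      rfl
    have heq : insert b B + (AddMonoidHom.mrange φ : Set M) =
        (B + (AddMonoidHom.mrange φ : Set M)) ∪
          (range (fun x => b + φ x) \ (B + (AddMonoidHom.mrange φ : Set M))) := by
      rw [insert_eq, union_add, hb, union_sdiff_self, union_comm]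
    rw [heq] at hfin ⊢
    have h₁ := hfin.mono subset_union_left
    have h₂ := hfin.mono subset_union_right
    rw [degSeries_union h₁ h₂ disjoint_sdiff_right]
    refine (ih h₁).add (isRationalSeries_coset_sdiff deg φ b ?_ h₂)
    rintro _ ⟨x, hx, y, hy, rfl⟩ k
    exact ⟨x, hx, y + φ k, add_mem hy ⟨k, rfl⟩, (add_assoc _ _ _).symm⟩

/-- By cancellation, each solution of `b + φ x = b' + φ' x'` is a minimal one plus a solution of the
homogeneous equation. Dickson's lemma bounds the minimal ones, and the homogeneous part does not
depend on `b`, `b'`. -/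
theorem IsFGSet.inter [IsCancelAdd M] {s t : Set M} (hs : IsFGSet s) (ht : IsFGSet t) :
    IsFGSet (s ∩ t) := by
  obtain ⟨B, Q, hB, hQ, rfl⟩ := hs
  obtain ⟨B', Q', hB', hQ', rfl⟩ := ht
  obtain ⟨m, φ, rfl⟩ := exists_addMonoidHom_of_fg hQ
  obtain ⟨m', φ', rfl⟩ := exists_addMonoidHom_of_fg hQ'
  let f : (Fin m → ℕ) × (Fin m' → ℕ) →+ M := φ.comp (AddMonoidHom.fst _ _)
  let g : (Fin m → ℕ) × (Fin m' → ℕ) →+ M := φ'.comp (AddMonoidHom.snd _ _)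
  let sol : M × M → Set ((Fin m → ℕ) × (Fin m' → ℕ)) := fun b => {x | b.1 + f x = b.2 + g x}
  let mins : M × M → Set ((Fin m → ℕ) × (Fin m' → ℕ)) := fun b => {x | Minimal (· ∈ sol b) x}
  refine ⟨⋃ b ∈ B ×ˢ B', (fun x => b.1 + f x) '' mins b, (f.eqLocusM g).map f, ?_,
    (AddSubmonoid.fg_eqLocusM f g).map f, ?_⟩
  · exact (hB.prod hB').biUnion fun b _ => Set.Finite.image _ <|
      (setOfPred_minimal_antichain _).finite_of_partiallyWellOrderedOn
        (Set.isPWO_of_wellQuasiOrderedLE _)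
  · ext z
    constructor
    · rintro ⟨⟨b, hb, _, ⟨x, rfl⟩, rfl⟩, ⟨b', hb', _, ⟨x', rfl⟩, h⟩⟩
      have hsol : (x, x') ∈ sol (b, b') := h.symm
      obtain ⟨y, hy, hmin⟩ := exists_minimal_le_of_wellFoundedLT (· ∈ sol (b, b')) _ hsol
      obtain ⟨k, hk⟩ := exists_add_of_le hy
      refine ⟨b + f y, mem_biUnion (mk_mem_prod hb hb') ⟨y, hmin, rfl⟩, f k, ⟨k, ?_, rfl⟩, ?_⟩
      · have h₁ : b + f y = b' + g y := hmin.1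
        have h₂ : b + f (x, x') = b' + g (x, x') := hsol
        rw [hk, map_add, map_add, ← add_assoc, ← add_assoc, h₁] at h₂
        exact add_left_cancel h₂
      · change b + f y + f k = b + f (x, x')
        rw [hk, map_add, add_assoc]
    · rintro ⟨_, hc, _, ⟨k, hk, rfl⟩, rfl⟩
      obtain ⟨b, hb, y, hy, rfl⟩ := mem_iUnion₂.1 hc
      have h₁ : b.1 + f y = b.2 + g y := hy.1
      have hk : f k = g k := hk
      refine ⟨⟨b.1, hb.1, f (y + k), ⟨_, rfl⟩, ?_⟩, ⟨b.2, hb.2, g (y + k), ⟨_, rfl⟩, ?_⟩⟩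
      · simp only [map_add, add_assoc]
      · change b.2 + g (y + k) = b.1 + f y + f k
        rw [h₁, hk, map_add, add_assoc]

/-- Inclusion–exclusion: the overlap of `s 0` with the rest is again a union of `n` such sets. -/
theorem isRationalSeries_iUnion [IsCancelAdd M] (deg : M →+ ℕ) {n : ℕ} (s : Fin n → Set M)
    (hs : ∀ i, IsFGSet (s i)) (hfin : GradedFinite deg (⋃ i, s i)) :
    IsRationalSeries (degSeries deg (⋃ i, s i)) := by
  induction n with
  | zero =>
    rw [iUnion_of_empty, degSeries_empty]
    exact .zero
  | succ n ih =>
    have heq : ⋃ i, s i = s 0 ∪ ⋃ i : Fin n, s i.succ := by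
      ext x; simp [Fin.exists_fin_succ]
    rw [heq] at hfin ⊢
    have h₁ := hfin.mono subset_union_left
    have h₂ := hfin.mono subset_union_right
    have h₃ := h₁.mono (inter_subset_left (t := ⋃ i : Fin n, s i.succ))
    rw [eq_sub_of_add_eq (degSeries_union_add_inter h₁ h₂)]
    refine (((hs 0).isRationalSeries deg h₁).add (ih _ (fun i => hs _) h₂)).sub ?_
    rw [inter_iUnion] at h₃ ⊢
    exact ih _ (fun i => (hs 0).inter (hs _)) h₃

theorem isRationalSeries_of_isSemilinearSet [IsCancelAdd M] (deg : M →+ ℕ) {s : Set M}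
    (hs : IsSemilinearSet s) (hfin : GradedFinite deg s) :
    IsRationalSeries (degSeries deg s) := by
  obtain ⟨S, hS, hlin, rfl⟩ := hs
  obtain ⟨n, t, -, rfl⟩ := hS.fin_param
  rw [sUnion_range] at hfin ⊢
  refine isRationalSeries_iUnion deg t (fun i => ?_) hfin
  obtain ⟨a, u, hu, h⟩ := hlin (t i) ⟨i, rfl⟩
  exact ⟨{a}, _, finite_singleton a, (AddSubmonoid.fg_iff _).2 ⟨u, rfl, hu⟩,
    by rw [h, singleton_add]; rfl⟩

theorem isSemilinearSet_sep_map_eq {N : Type*} [AddCommMonoid N] {s : Set M}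
    (hs : IsSemilinearSet s) (f : M →+ N) (c : N) : IsSemilinearSet {x ∈ s | f x = c} := by
  obtain ⟨S, hS, hlin, rfl⟩ := hs
  have heq : {x | x ∈ ⋃₀ S ∧ f x = c} = ⋃ t ∈ S, {x ∈ t | f x = c} := by
    ext x
    simp only [mem_ofPred_eq, mem_sUnion, mem_iUnion, exists_prop]
    tauto
  rw [heq]
  refine .biUnion hS fun t ht => ?_
  obtain ⟨a, Q, hQ, rfl⟩ := isLinearSet_iff_exists_fg_eq_vadd.1 (hlin t ht)
  obtain ⟨m, φ, rfl⟩ := exists_addMonoidHom_of_fg hQ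
  convert! ((isSemilinearSet_setOfPred_eq (f a) c (f.comp φ) (0 : (Fin m → ℕ) →+ N)).image φ).vadd a
    using 1
  ext x
  simp only [mem_ofPred_eq, mem_vadd_set, vadd_eq_add]
  constructor
  · rintro ⟨⟨_, ⟨y, rfl⟩, rfl⟩, h⟩
    exact ⟨φ y, ⟨y, by simpa using h, rfl⟩, rfl⟩
  · rintro ⟨_, ⟨y, hy, rfl⟩, rfl⟩
    exact ⟨⟨φ y, ⟨y, rfl⟩, rfl⟩, by simpa using hy⟩

/-! ### Labels of paths in a finite graph -/

section Path

variable {V : Type*} (lab : V → V → Set M)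

/-- `IsPathLabel lab T i j x` says that `x` is the sum of the labels along a nonempty path
from `i` to `j` all of whose intermediate vertices lie in `T`. -/
inductive IsPathLabel (T : Set V) : V → V → M → Prop
  | single {i j x} : x ∈ lab i j → IsPathLabel T i j x
  | cons {i k j x y} : x ∈ lab i k → k ∈ T → IsPathLabel T k j y → IsPathLabel T i j (x + y)

variable {lab}

theorem IsPathLabel.mono {T T' : Set V} (h : T ⊆ T') {i j : V} {x : M}
    (hx : IsPathLabel lab T i j x) : IsPathLabel lab T' i j x := by
  induction hx with
  | single hx => exact .single hx
  | cons hx hk _ ih => exact .cons hx (h hk) ih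

theorem IsPathLabel.trans {T : Set V} {i k j : V} {x y : M} (hx : IsPathLabel lab T i k x)
    (hk : k ∈ T) (hy : IsPathLabel lab T k j y) : IsPathLabel lab T i j (x + y) := by
  induction hx with
  | single hx => exact .cons hx hk hy
  | cons hx hl _ ih =>
    rw [add_assoc]
    exact .cons hx hl (ih hk hy)

/-- Kleene's recursion: cut a path at its visits to `k`. -/
theorem setOf_isPathLabel_insert (T : Set V) (k i j : V) :
    {x | IsPathLabel lab (insert k T) i j x} = {x | IsPathLabel lab T i j x} ∪
      ({x | IsPathLabel lab T i k x} + (AddSubmonoid.closure {x | IsPathLabel lab T k k x} : Set M)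
        + {x | IsPathLabel lab T k j x}) := by
  ext z
  constructor
  · intro hz
    induction hz with
    | single hx => exact Or.inl (.single hx)
    | @cons i l j x y hx hl _ ih =>
      rcases ih with h | ⟨_, ⟨p, hp, c, hc, rfl⟩, q, hq, rfl⟩
      · rcases hl with rfl | hl
        · exact Or.inr ⟨_, ⟨x, .single hx, 0, zero_mem _, rfl⟩, y, h, by simp⟩
        · exact Or.inl (.cons hx hl h)
      · right
        rcases hl with rfl | hl
        · exact ⟨_, ⟨x, .single hx, p + c,
            add_mem (AddSubmonoid.subset_closure hp) hc, rfl⟩, q, hq, by simp [add_assoc]⟩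
        · exact ⟨_, ⟨x + p, .cons hx hl hp, c, hc, rfl⟩, q, hq, by simp [add_assoc]⟩
  · have hsub : T ⊆ insert k T := subset_insert k T
    have hk : k ∈ insert k T := mem_insert k T
    rintro (h | ⟨_, ⟨p, hp, c, hc, rfl⟩, q, hq, rfl⟩)
    · exact IsPathLabel.mono hsub h
    · have hloop : ∀ q, IsPathLabel lab (insert k T) k j q →
          IsPathLabel lab (insert k T) k j (c + q) := by
        induction hc using AddSubmonoid.closure_induction with
        | mem c hc => exact fun q hq => (IsPathLabel.mono hsub hc).trans hk hq
        | zero => simp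
        | add c d _ _ hc hd =>
          intro q hq
          rw [add_assoc]
          exact hc _ (hd q hq)
      change IsPathLabel lab (insert k T) i j (p + c + q)
      rw [add_assoc]
      exact (IsPathLabel.mono hsub hp).trans hk (hloop q (IsPathLabel.mono hsub hq))

theorem isSemilinearSet_isPathLabel (hlab : ∀ i j, (lab i j).Finite) {T : Set V} (hT : T.Finite)
    (i j : V) : IsSemilinearSet {x | IsPathLabel lab T i j x} := by
  induction T, hT using Set.Finite.induction_on generalizing i j with
  | empty =>
    convert IsSemilinearSet.of_finite (hlab i j) using 1
    ext x
    refine ⟨fun h => ?_, .single⟩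
    cases h with
    | single h => exact h
    | cons _ h _ => exact absurd h (notMem_empty _)
  | insert _ _ ih =>
    rw [setOf_isPathLabel_insert]
    exact (ih i j).union (((ih i _).add (ih _ _).closure).add (ih _ j))

end Path

open scoped IsMulCommutative

theorem isRationalSeries_biUnion_of_pairwiseDisjoint {α ι : Type*} {deg : α → ℕ} (T : Finset ι)
    {s : ι → Set α} (hdisj : Pairwise (Function.onFun Disjoint s))
    (hfin : GradedFinite deg (⋃ i, s i)) (hs : ∀ i, IsRationalSeries (degSeries deg (s i))) :
    IsRationalSeries (degSeries deg (⋃ i ∈ T, s i)) := by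
  classical
  induction T using Finset.cons_induction with
  | empty => simpa [degSeries_empty] using IsRationalSeries.zero
  | cons a T ha ih =>
    rw [Finset.cons_eq_insert, Finset.set_biUnion_insert,
      degSeries_union (hfin.mono (subset_iUnion s a)) (hfin.mono (iUnion₂_subset_iUnion _ _))]
    · exact (hs a).add ih
    · rw [disjoint_iUnion₂_right]
      intro i hi
      exact hdisj fun h => ha (h ▸ hi)

/-! ### Words, cosets and balls -/

@[simp]
theorem wordWeight_nil {G : Type*} {S : Finset G} (ω : S → ℕ+) : wordWeight ω [] = 0 := rfl

@[simp]
theorem wordWeight_cons {G : Type*} {S : Finset G} (ω : S → ℕ+) (s : S) (w : List S) :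
    wordWeight ω (s :: w) = ω s + wordWeight ω w := by
  simp [wordWeight]

variable {G : Type*} [Group G] {S : Finset G} (ω : S → ℕ+)

@[simp]
theorem wordEval_nil : wordEval ([] : List S) = 1 := rfl

@[simp]
theorem wordEval_cons (s : S) (w : List S) : wordEval (s :: w) = s * wordEval w := by
  simp [wordEval]

section Coset

variable (A : Subgroup G)

/-- The label of the edge from `k` to `i` given by a letter `s`, relative to the chosen coset
representatives: the element of `A` relating `s * k.out` to `i.out`, with the weight of `s`. -/
def edgeLabel (i k : G ⧸ A) : Set (Additive A × ℕ) :=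
  {x | ∃ s : S, (s : G) * k.out = i.out * (x.1.toMul : G) ∧ x.2 = ω s}

/-- The elements of `A`, with weights, of the words that take the coset `j` to the coset `i`. -/
def wordLabels (i j : G ⧸ A) : Set (Additive A × ℕ) :=
  {x | ∃ w : List S, wordEval w * j.out = i.out * (x.1.toMul : G) ∧ wordWeight ω w = x.2}

theorem finite_edgeLabel (i k : G ⧸ A) : (edgeLabel ω A i k).Finite := by
  have h : edgeLabel ω A i k = ⋃ s : S,
      {x : Additive A × ℕ | (s : G) * k.out = i.out * (x.1.toMul : G) ∧ x.2 = ω s} := by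
    ext; simp [edgeLabel]
  rw [h]
  refine finite_iUnion fun s => Set.Subsingleton.finite ?_
  rintro x ⟨hx, hx'⟩ y ⟨hy, hy'⟩
  refine Prod.ext (Additive.toMul.injective (Subtype.ext ?_)) (hx'.trans hy'.symm)
  exact mul_left_cancel (hx.symm.trans hy)

theorem isPathLabel_edgeLabel_iff [IsMulCommutative A] (i j : G ⧸ A) (x : Additive A × ℕ) :
    IsPathLabel (edgeLabel ω A) univ i j x ↔ ∃ w : List S, w ≠ [] ∧
      wordEval w * j.out = i.out * (x.1.toMul : G) ∧ wordWeight ω w = x.2 := by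
  constructor
  · intro h
    induction h with
    | single hx =>
      obtain ⟨s, hs, hs'⟩ := hx
      exact ⟨[s], by simp, by simpa using hs, by simp [hs']⟩
    | cons hx _ _ ih =>
      obtain ⟨s, hs, hs'⟩ := hx
      obtain ⟨w, -, hw, hw'⟩ := ih
      refine ⟨s :: w, by simp, ?_, by simp [hs', hw']⟩
      rw [wordEval_cons, mul_assoc, hw, ← mul_assoc, hs, mul_assoc]
      rfl
  · rintro ⟨w, hne, hw, hw'⟩
    induction w generalizing i x with
    | nil => exact absurd rfl hne
    | cons s w ih =>
      rcases eq_or_ne w [] with rfl | hne'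
      · exact .single ⟨s, by simpa using hw, by simpa using hw'.symm⟩
      -- `k` is the coset reached by the tail and `a` its `A`-part; the first edge carries the
      -- remaining factor.
      · let k : G ⧸ A := ((wordEval w * j.out : G) : G ⧸ A)
        have hk : (k.out)⁻¹ * (wordEval w * j.out) ∈ A :=
          QuotientGroup.eq.1 (QuotientGroup.out_eq' k)
        let a : A := ⟨_, hk⟩
        have ha : wordEval w * j.out = k.out * (a : G) := by simp [a]
        have hx : x = (Additive.ofMul (x.1.toMul * a⁻¹), (ω s : ℕ)) +
            (Additive.ofMul a, wordWeight ω w) := by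
          refine Prod.ext ?_ (by simpa using hw'.symm)
          apply Additive.toMul.injective
          simp
        rw [hx]
        refine .cons ⟨s, ?_, rfl⟩ (mem_univ k) (ih k _ hne' ha rfl)
        rw [wordEval_cons, mul_assoc, ha] at hw
        simp [← mul_assoc, ← hw]

theorem isSemilinearSet_wordLabels [IsMulCommutative A] [A.FiniteIndex] (i j : G ⧸ A) :
    IsSemilinearSet (wordLabels ω A i j) := by
  have h : wordLabels ω A i j = {x | IsPathLabel (edgeLabel ω A) univ i j x} ∪
      {x | j.out = i.out * (x.1.toMul : G) ∧ 0 = x.2} := by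
    ext x
    simp only [wordLabels, mem_union, mem_ofPred_eq, isPathLabel_edgeLabel_iff]
    constructor
    · rintro ⟨w, hw, hw'⟩
      rcases eq_or_ne w [] with rfl | hne
      · exact Or.inr ⟨by simpa using hw, by simpa using hw'⟩
      · exact Or.inl ⟨w, hne, hw, hw'⟩
    · rintro (⟨w, -, hw, hw'⟩ | ⟨hw, hw'⟩)
      · exact ⟨w, hw, hw'⟩
      · exact ⟨[], by simpa using hw, by simpa using hw'⟩
  rw [h]
  refine (isSemilinearSet_isPathLabel (finite_edgeLabel ω A) (toFinite _) i j).union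
    (.of_finite (Set.Subsingleton.finite ?_))
  rintro x ⟨hx, hx'⟩ y ⟨hy, hy'⟩
  refine Prod.ext (Additive.toMul.injective (Subtype.ext ?_)) (hx'.symm.trans hy')
  exact mul_left_cancel (hx.symm.trans hy)

/-- The part in the coset `i` of the set of pairs `(h, n)` with `h ∈ H` of weight at most `n`. -/
def cosetBall (H : Subgroup G) (i j : G ⧸ A) : Set (Additive A × ℕ) :=
  {x | i.out * (x.1.toMul : G) * (j.out)⁻¹ ∈ H ∧
    weight ω (i.out * (x.1.toMul : G) * (j.out)⁻¹) ≤ x.2}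

theorem weight_wordEval_le (w : List S) : weight ω (wordEval w) ≤ wordWeight ω w :=
  Nat.sInf_le ⟨w, rfl, rfl⟩

theorem isSemilinearSet_cosetBall (hS : Submonoid.closure (S : Set G) = ⊤) [IsMulCommutative A]
    [A.FiniteIndex] (H : Subgroup G) (i j : G ⧸ A) : IsSemilinearSet (cosetBall ω A H i j) := by
  have hball : IsSemilinearSet {x : Additive A × ℕ |
      weight ω (i.out * (x.1.toMul : G) * (j.out)⁻¹) ≤ x.2} := by
    convert (isSemilinearSet_wordLabels ω A i j).add
      ((IsSemilinearSet.univ (M := ℕ)).image (AddMonoidHom.inr (Additive A) ℕ)) using 1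
    ext x
    constructor
    · intro hx
      obtain ⟨w, hw, hw'⟩ := exists_word_weight hS ω (i.out * (x.1.toMul : G) * (j.out)⁻¹)
      refine ⟨(x.1, wordWeight ω w), ⟨w, by simp [hw], rfl⟩, _,
        ⟨x.2 - wordWeight ω w, trivial, rfl⟩, Prod.ext (by simp) ?_⟩
      rw [mem_ofPred_eq, ← hw'] at hx
      simpa using Nat.add_sub_cancel' hx
    · rintro ⟨y, ⟨w, hw, hw'⟩, _, ⟨n, -, rfl⟩, rfl⟩
      have := weight_wordEval_le ω w
      rw [eq_mul_inv_of_mul_eq hw] at this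
      simp only [mem_ofPred_eq, Prod.fst_add, AddMonoidHom.inr_apply, add_zero, Prod.snd_add]
      omega
  by_cases hne : ∃ a : A, i.out * (a : G) * (j.out)⁻¹ ∈ H
  · obtain ⟨a, ha⟩ := hne
    -- Once one `a` satisfies the condition, the others form the coset `a K`, a fibre of `A → A ⧸
    -- K`.
    let K : Subgroup A := (H.comap (MulAut.conj j.out).toMonoidHom).subgroupOf A
    convert isSemilinearSet_sep_map_eq hball
      ((QuotientGroup.mk' K).toAdditive.comp (AddMonoidHom.fst (Additive A) ℕ))
      (Additive.ofMul (a : A ⧸ K)) using 1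
    ext x
    simp only [cosetBall, mem_ofPred_eq]
    rw [and_comm]
    refine and_congr_right fun _ => ?_
    have h₁ : (((QuotientGroup.mk' K).toAdditive.comp (AddMonoidHom.fst (Additive A) ℕ)) x =
        Additive.ofMul (a : A ⧸ K)) ↔ (a : A ⧸ K) = (x.1.toMul : A ⧸ K) := by
      rw [eq_comm]
      exact Iff.rfl
    rw [h₁, QuotientGroup.eq]
    have h₂ : i.out * (x.1.toMul : G) * (j.out)⁻¹ = (i.out * (a : G) * (j.out)⁻¹) *
        (j.out * ((a : G)⁻¹ * (x.1.toMul : G)) * (j.out)⁻¹) := by group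
    rw [h₂, H.mul_mem_cancel_left ha]
    exact Iff.rfl
  · convert IsSemilinearSet.empty (M := Additive A × ℕ) using 1
    rw [eq_empty_iff_forall_notMem]
    rintro x ⟨hx, -⟩
    exact hne ⟨_, hx⟩

end Coset

/-- The set of pairs `(h, n)` with `h ∈ H` of weight at most `n`. -/
def ballSet (H : Subgroup G) : Set (G × ℕ) := {p | p.1 ∈ H ∧ weight ω p.1 ≤ p.2}

theorem gradedFinite_ballSet (hS : Submonoid.closure (S : Set G) = ⊤) (H : Subgroup G) :
    GradedFinite Prod.snd (ballSet ω H) := by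
  intro n
  refine (((finite_Iic n).biUnion fun k _ => finite_sphere hS ω H k).image
    fun g => (g, n)).subset ?_
  rintro ⟨g, _⟩ ⟨⟨hg, hw⟩, rfl⟩
  exact ⟨g, mem_biUnion (mem_Iic.2 hw) ⟨hg, rfl⟩, rfl⟩

/-- A pair lies on the graph of the weight or is a shift by one of another pair, exclusively. -/
theorem degSeries_ballSet (hS : Submonoid.closure (S : Set G) = ⊤) (H : Subgroup G) :
    degSeries Prod.snd (ballSet ω H) =
      relGrowthSeries ω H + PowerSeries.X * degSeries Prod.snd (ballSet ω H) := by
  have hfin := gradedFinite_ballSet ω hS H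
  have heq : ballSet ω H =
      (fun g => (g, weight ω g)) '' (H : Set G) ∪ (fun p => (p.1, p.2 + 1)) '' ballSet ω H := by
    ext ⟨g, n⟩
    constructor
    · rintro ⟨hg, hn⟩
      rcases hn.eq_or_lt with h | h
      · exact Or.inl ⟨g, hg, Prod.ext rfl h⟩
      · exact Or.inr ⟨(g, n - 1), ⟨hg, by simp only at h ⊢; omega⟩,
          Prod.ext rfl (by simp only at h ⊢; omega)⟩
    · rintro (⟨h, hh, hp⟩ | ⟨p, ⟨hp, hp'⟩, hpq⟩)
      · cases hp
        exact ⟨hh, le_rfl⟩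
      · cases hpq
        exact ⟨hp, by simp only at hp' ⊢; omega⟩
  have hgrowth : relGrowthSeries ω H = degSeries (weight ω) (H : Set G) := rfl
  have hsub₁ := hfin.mono (subset_union_left.trans heq.symm.subset)
  have hsub₂ := hfin.mono (subset_union_right.trans heq.symm.subset)
  conv_lhs => rw [heq]
  rw [degSeries_union hsub₁ hsub₂, hgrowth,
    degSeries_image (deg := weight ω) 0 _ (by simp),
    degSeries_image (deg := Prod.snd) 1 _ (by simp [add_comm])]
  · simp
  · rintro ⟨g, n⟩ _ ⟨g', n'⟩ _ h
    simpa using h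
  · intro g _ g' _ h
    exact congrArg Prod.fst h
  · rw [Set.disjoint_left]
    rintro _ ⟨g, -, rfl⟩ ⟨⟨h, n⟩, ⟨-, hn⟩, hp⟩
    simp only [Prod.mk.injEq] at hp hn
    obtain ⟨rfl, hp⟩ := hp
    omega

theorem isRationalSeries_ballSet (hG : IsVirtuallyAbelian G)
    (hS : Submonoid.closure (S : Set G) = ⊤) (H : Subgroup G) :
    IsRationalSeries (degSeries Prod.snd (ballSet ω H)) := by
  obtain ⟨A, hA, hA'⟩ := hG
  -- Any fixed coset would do; `j.out` need not be `1`, hence the factor `(j.out)⁻¹` in `f`.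
  let j : G ⧸ A := ((1 : G) : G ⧸ A)
  let f : G ⧸ A → Additive A × ℕ → G × ℕ :=
    fun i x => (i.out * (x.1.toMul : G) * (j.out)⁻¹, x.2)
  have hinj : ∀ i, Function.Injective (f i) := by
    intro i x y h
    simp only [f, Prod.mk.injEq, mul_left_inj, mul_right_inj] at h
    exact Prod.ext (Additive.toMul.injective (Subtype.ext h.1)) h.2
  have hdeg : ∀ i, ∀ x ∈ cosetBall ω A H i j, (f i x).2 = 0 + x.2 := by simp [f]
  have heq : ballSet ω H = ⋃ i, f i '' cosetBall ω A H i j := by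
    ext ⟨g, n⟩
    simp only [mem_iUnion]
    constructor
    · rintro ⟨hg, hn⟩
      let i : G ⧸ A := ((g * j.out : G) : G ⧸ A)
      have hi : (i.out)⁻¹ * (g * j.out) ∈ A := QuotientGroup.eq.1 (QuotientGroup.out_eq' i)
      have hgi : i.out * ((i.out)⁻¹ * (g * j.out)) * (j.out)⁻¹ = g := by group
      refine ⟨i, (Additive.ofMul ⟨_, hi⟩, n), ⟨?_, ?_⟩, Prod.ext hgi rfl⟩
      · simpa only [toMul_ofMul, hgi] using hg
      · simpa only [toMul_ofMul, hgi] using hn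
    · rintro ⟨i, x, ⟨hx, hx'⟩, h⟩
      cases h
      exact ⟨hx, hx'⟩
  have hfin := gradedFinite_ballSet ω hS H
  rw [heq] at hfin ⊢
  have := Fintype.ofFinite (G ⧸ A)
  rw [← Set.biUnion_univ, ← Finset.coe_univ]
  refine isRationalSeries_biUnion_of_pairwiseDisjoint Finset.univ ?_ hfin fun i => ?_
  · intro i k hik
    refine Set.disjoint_left.2 ?_
    rintro _ ⟨x, -, rfl⟩ ⟨y, -, h⟩
    simp only [f, Prod.mk.injEq, mul_left_inj] at h
    refine hik ?_
    rw [← QuotientGroup.out_eq' i, ← QuotientGroup.out_eq' k,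
      ← QuotientGroup.mk_mul_of_mem i.out x.1.toMul.2, ← h.1,
      QuotientGroup.mk_mul_of_mem k.out y.1.toMul.2]
  · have hfin' := hfin.mono (subset_iUnion (fun i => f i '' cosetBall ω A H i j) i)
    rw [degSeries_image (deg := Prod.snd) 0 (hinj i).injOn (hdeg i)]
    exact (isRationalSeries_of_isSemilinearSet (AddMonoidHom.snd (Additive A) ℕ)
      (isSemilinearSet_cosetBall ω A hS H i j)
      (hfin'.of_image 0 (hinj i).injOn (hdeg i))).X_pow_mul 0

end RelGrowth

theorem theoremA {G : Type*} [Group G] (hG : RelGrowth.IsVirtuallyAbelian G)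
    (S : Finset G) (hS : Submonoid.closure (S : Set G) = ⊤) (ω : S → ℕ+) (H : Subgroup G) :
    RelGrowth.IsRationalSeries (RelGrowth.relGrowthSeries ω H) := by
  have h := RelGrowth.degSeries_ballSet ω hS H
  have hmul : ((1 - Polynomial.X : Polynomial ℤ) : PowerSeries ℤ) *
      RelGrowth.degSeries Prod.snd (RelGrowth.ballSet ω H) = RelGrowth.relGrowthSeries ω H := by
    push_cast
    linear_combination h
  rw [← hmul]
  exact (RelGrowth.isRationalSeries_ballSet ω hG hS H).polynomial_mul _
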